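/- Let $M=M(x_0,x_1,x_2)$ be a symmetric $3\times 3$ matrix whose entries are real homogeneous polynomials of degree two in $x_0,x_1,x_2$ (the zero polynomial being allowed as an entry), and suppose that the real symmetric matrix $M(a)$ is positive semidefinite for every $a\in\mathbb{R}^3$. If there is a nonzero $a\in\mathbb{R}^3$ such that the kernel of $M(a)$ has dimension at least two, then $F=\det M$ is a sum of squares of cubic forms: there are finitely many $g_1,\dots,g_k\in\mathbb{R}[x_0,x_1,x_2]$, each homogeneous of degree three (possibly zero), such that $$\det M=\sum_{i=1}^k g_i^2 .$$ -/

import Mathlib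

/-! A constant congruence puts two kernel vectors of `M(a)` at the last two basis vectors and
multiplies `det M` by a nonzero square. On the affine plane of points `s • a + t • u + w`, the
lower-right 2×2 block then has no `s ^ 2` terms, and positivity kills its terms linear in `s`. So
the determinant is `p s ^ 2 + 2 q s + r` with `p, q, r` polynomials in `t`, `deg p ≤ 4`, `deg r ≤ 6`
(`det_eq_sum_sq_of_eval_eq_zero`). Being nonnegative in `s`, it gives a 2×2 matrix that is positive
semidefinite for every `t`.

Such a matrix is a sum of rank-one squares (`PsdPair.sosPair`), so the determinant is `∑ (α i * s +
β i) ^ 2` with `deg α i ≤ 2`, `deg β i ≤ 3`. Homogenizing yields cubic forms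
(`exists_sum_sq_of_quadratic`). -/

open Polynomial in
/-- The symmetric matrix with rows `(p, q)` and `(q, r)` is positive semidefinite at every point. -/
def PsdPair (p q r : ℝ[X]) : Prop :=
  ∀ t u v : ℝ, 0 ≤ p.eval t * u ^ 2 + 2 * q.eval t * u * v + r.eval t * v ^ 2

open Polynomial in
/-- The symmetric matrix with rows `(p, q)` and `(q, r)` is a finite sum of matrices
with rows `(a ^ 2, a * b)` and `(a * b, b ^ 2)`. -/
def SosPair (p q r : ℝ[X]) : Prop :=
  ∃ (k : ℕ) (a b : Fin k → ℝ[X]), p = ∑ i, a i ^ 2 ∧ q = ∑ i, a i * b i ∧ r = ∑ i, b i ^ 2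

/-! ### Positive semidefinite 2×2 matrices over `ℝ[X]`. -/

section Univariate

open Polynomial Filter Topology

theorem SosPair.congruence {p q r : ℝ[X]} (h : SosPair p q r) (x y z w : ℝ[X]) :
    SosPair (x ^ 2 * p + 2 * x * y * q + y ^ 2 * r)
      (x * z * p + (x * w + y * z) * q + y * w * r)
      (z ^ 2 * p + 2 * z * w * q + w ^ 2 * r) := by
  obtain ⟨k, a, b, rfl, rfl, rfl⟩ := h
  refine ⟨k, fun i => x * a i + y * b i, fun i => z * a i + w * b i, ?_, ?_, ?_⟩ <;>
  · simp only [Finset.mul_sum, ← Finset.sum_add_distrib]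
    exact Finset.sum_congr rfl fun i _ => by ring

theorem SosPair.swap {p q r : ℝ[X]} (h : SosPair p q r) : SosPair r q p := by
  have := h.congruence 0 1 1 0
  simpa using this

theorem SosPair.add_sq {p q r : ℝ[X]} (h : SosPair p q r) (c d : ℝ[X]) :
    SosPair (c ^ 2 + p) (c * d + q) (d ^ 2 + r) := by
  obtain ⟨k, a, b, rfl, rfl, rfl⟩ := h
  exact ⟨k + 1, Fin.cons c a, Fin.cons d b, by simp [Fin.sum_univ_succ],
    by simp [Fin.sum_univ_succ], by simp [Fin.sum_univ_succ]⟩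

theorem SosPair.zero : SosPair 0 0 0 := ⟨0, 0, 0, by simp, by simp, by simp⟩

theorem SosPair.diag_const {a c : ℝ} (ha : 0 ≤ a) (hc : 0 ≤ c) : SosPair (C a) 0 (C c) := by
  have := (SosPair.zero.add_sq (C √a) 0).add_sq 0 (C √c)
  simpa [← C_pow, Real.sq_sqrt ha, Real.sq_sqrt hc] using this

theorem PsdPair.swap {p q r : ℝ[X]} (h : PsdPair p q r) : PsdPair r q p := fun t u v => by
  linarith [h t v u]

theorem PsdPair.left_nonneg {p q r : ℝ[X]} (h : PsdPair p q r) (t : ℝ) : 0 ≤ p.eval t := by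
  simpa using h t 1 0

theorem PsdPair.right_nonneg {p q r : ℝ[X]} (h : PsdPair p q r) (t : ℝ) : 0 ≤ r.eval t := by
  simpa using h t 0 1

theorem PsdPair.sq_le {p q r : ℝ[X]} (h : PsdPair p q r) (t : ℝ) :
    q.eval t ^ 2 ≤ p.eval t * r.eval t := by
  have h1 : ∀ x : ℝ, 0 ≤ p.eval t * (x * x) + 2 * q.eval t * x + r.eval t := fun x => by
    linarith [h t x 1]
  have := discrim_le_zero h1
  rw [discrim] at this
  linarith

theorem PsdPair.shift {p q r : ℝ[X]} (h : PsdPair p q r) (m : ℝ[X]) :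
    PsdPair p (q - m * p) (r - 2 * m * q + m ^ 2 * p) := fun t u v => by
  have := h t (u - m.eval t * v) v
  simp only [eval_sub, eval_add, eval_mul, eval_pow, eval_ofNat]
  linarith

theorem eval_nonneg_of_ne {f : ℝ[X]} {a : ℝ} (h : ∀ t, t ≠ a → 0 ≤ f.eval t) (t : ℝ) :
    0 ≤ f.eval t := by
  rcases eq_or_ne t a with rfl | ht
  · have : Tendsto (fun x => f.eval x) (𝓝[≠] t) (𝓝 (f.eval t)) :=
      (f.continuous.tendsto t).mono_left nhdsWithin_le_nhds
    exact ge_of_tendsto this (eventually_nhdsWithin_of_forall fun x hx => h x hx)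
  · exact h t ht

theorem exists_eq_sq_mul_of_nonneg {f : ℝ[X]} (h : ∀ t, 0 ≤ f.eval t) {a : ℝ}
    (ha : f.eval a = 0) : ∃ g : ℝ[X], f = (X - C a) ^ 2 * g := by
  obtain ⟨g, rfl⟩ := dvd_iff_isRoot.2 ha
  have hmin : IsLocalMin (fun x => ((X - C a) * g).eval x) a :=
    Eventually.of_forall fun x => ha.le.trans (h x)
  have hd := hmin.deriv_eq_zero
  rw [Polynomial.deriv] at hd
  have hg : g.eval a = 0 := by simpa using hd
  obtain ⟨g', rfl⟩ := dvd_iff_isRoot.2 hg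
  exact ⟨g', by ring⟩

/-- A zero of the nonnegative `r` is double, and `q ^ 2 ≤ p * r` makes `q` vanish there too. Away
from `a` the quotient is congruent to the original by `diag(1, 1 / (t - a))`; continuity covers `a`.
-/
theorem PsdPair.extract {p q r : ℝ[X]} (h : PsdPair p q r) {a : ℝ} (ha : r.eval a = 0) :
    ∃ q₁ r₁ : ℝ[X], q = (X - C a) * q₁ ∧ r = (X - C a) ^ 2 * r₁ ∧ PsdPair p q₁ r₁ := by
  have hq : q.eval a = 0 := by
    have := h.sq_le a
    rw [ha, mul_zero] at this
    exact pow_eq_zero_iff two_ne_zero |>.1 (le_antisymm this (sq_nonneg _))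
  obtain ⟨r₁, rfl⟩ := exists_eq_sq_mul_of_nonneg h.right_nonneg ha
  obtain ⟨q₁, rfl⟩ := dvd_iff_isRoot.2 hq
  refine ⟨q₁, r₁, rfl, rfl, fun t u v => ?_⟩
  have key := eval_nonneg_of_ne (f := p * C (u ^ 2) + 2 * q₁ * C u * C v + r₁ * C (v ^ 2)) (a := a)
    (fun t ht => by
      have hta : t - a ≠ 0 := sub_ne_zero.2 ht
      have := h t u (v / (t - a))
      simp only [eval_add, eval_mul, eval_sub, eval_pow, eval_X, eval_C, eval_ofNat] at this ⊢
      convert this using 1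
      field_simp) t
  simpa using key

theorem natDegree_sq_mul {r : ℝ[X]} (hr : r ≠ 0) (a : ℝ) :
    ((X - C a) ^ 2 * r).natDegree = r.natDegree + 2 := by
  rw [natDegree_mul (pow_ne_zero _ (X_sub_C_ne_zero a)) hr, natDegree_pow, natDegree_X_sub_C]
  ring

theorem degree_le_of_abs_eval_le {f g : ℝ[X]} (h : ∀ t, |f.eval t| ≤ |g.eval t|) :
    f.degree ≤ g.degree := by
  rcases eq_or_ne g 0 with rfl | hg
  · have : f = 0 := Polynomial.funext fun t => by simpa using h t
    simp [this]
  by_contra! hlt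
  have ht := abs_div_tendsto_atTop_atTop_of_degree_gt f g hlt hg
  obtain ⟨t, ht⟩ := (ht.eventually_gt_atTop 1).exists
  rw [abs_div] at ht
  exact absurd ht (not_lt.2 (div_le_one_of_le₀ (h t) (abs_nonneg _)))

theorem exists_forall_div_le {f g : ℝ[X]} (hfg : g.degree < f.degree) (hf : ∀ t, 0 ≤ f.eval t)
    (hg : ∀ t, 0 < g.eval t) :
    ∃ a, ∀ t, f.eval a / g.eval a ≤ f.eval t / g.eval t := by
  have hg0 : g ≠ 0 := by
    rintro rfl
    simpa using hg 0
  have hcont : Continuous fun t => f.eval t / g.eval t :=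
    f.continuous.div g.continuous fun t => (hg t).ne'
  have htop : Tendsto (fun t => f.eval t / g.eval t) atTop atTop := by
    refine (abs_div_tendsto_atTop_atTop_of_degree_gt f g hfg hg0).congr fun t => ?_
    exact abs_of_nonneg (div_nonneg (hf t) (hg t).le)
  have hbot : Tendsto (fun t => f.eval t / g.eval t) atBot atTop := by
    have hdeg : ∀ h : ℝ[X], (h.comp (-X)).degree = h.degree := fun h => by
      rcases eq_or_ne h 0 with rfl | hh
      · simp
      have hc : h.comp (-X) ≠ 0 := fun h0 => hh <| by
        have := congrArg (fun z => z.comp (-X : ℝ[X])) h0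
        simpa [comp_assoc] using this
      rw [degree_eq_natDegree hh, degree_eq_natDegree hc, natDegree_comp]
      simp
    have h1 := abs_div_tendsto_atTop_atTop_of_degree_gt (f.comp (-X)) (g.comp (-X))
      (by rwa [hdeg, hdeg]) (fun h0 => hg0 <| by
        have := hdeg g
        rw [h0, degree_zero] at this
        exact degree_eq_bot.1 this.symm)
    refine (h1.comp tendsto_neg_atBot_atTop).congr fun t => ?_
    simp only [Function.comp, eval_comp, eval_neg, eval_X, neg_neg]
    exact abs_of_nonneg (div_nonneg (hf t) (hg t).le)
  refine hcont.exists_forall_le ?_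
  rw [cocompact_eq_atBot_atTop]
  exact hbot.sup htop

/-- A reduced pair whose second diagonal entry is not constant splits off a constant square
and then acquires a root. -/
theorem PsdPair.exists_extract {p q r : ℝ[X]} (h : PsdPair p q r) (hp : ∀ t, 0 < p.eval t)
    (hqp : q.degree < p.degree) (hpr : p.natDegree ≤ r.natDegree) (hr : 0 < r.natDegree) :
    ∃ q₁ r₁ : ℝ[X], PsdPair p q₁ r₁ ∧ r₁.natDegree < r.natDegree ∧
      (SosPair p q₁ r₁ → SosPair p q r) := by
  have hp0 : p ≠ 0 := by
    rintro rfl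
    simpa using hp 0
  have hr0 : r ≠ 0 := by
    rintro rfl
    simp at hr
  -- This makes `(p * r - q ^ 2) / p` tend to infinity at both ends, so its minimum is attained.
  have hdeg : p.degree < (p * r - q ^ 2).degree := by
    have hq2 : (q ^ 2).degree < (p * r).degree := by
      rcases eq_or_ne q 0 with rfl | hq0
      · simp [bot_lt_iff_ne_bot, hp0, hr0]
      · have := natDegree_lt_natDegree hq0 hqp
        rw [degree_eq_natDegree (pow_ne_zero 2 hq0), degree_eq_natDegree (mul_ne_zero hp0 hr0),
          natDegree_pow, natDegree_mul hp0 hr0]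
        exact_mod_cast (by omega)
    rw [degree_sub_eq_left_of_degree_lt hq2, degree_eq_natDegree hp0,
      degree_eq_natDegree (mul_ne_zero hp0 hr0), natDegree_mul hp0 hr0]
    exact_mod_cast (by omega)
  have hD : ∀ t, 0 ≤ (p * r - q ^ 2).eval t := fun t => by
    have := h.sq_le t
    simp only [eval_sub, eval_mul, eval_pow]
    linarith
  obtain ⟨a, ha⟩ := exists_forall_div_le hdeg hD hp
  -- `l` is the largest constant that can be subtracted from `r` while keeping semidefiniteness. The
  -- result is singular at `a`, and the shift by `s` moves its kernel there to the second basis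
  -- vector.
  set l : ℝ := (p * r - q ^ 2).eval a / p.eval a with hl
  have hl0 : 0 ≤ l := div_nonneg (hD a) (hp a).le
  set s : ℝ := - q.eval a / p.eval a with hs
  have hpsd : PsdPair p (q + C s * p) (r + 2 * C s * q + C s ^ 2 * p - C l) := fun t u v => by
    have h1 := ha t
    rw [le_div_iff₀ (hp t)] at h1
    simp only [eval_add, eval_sub, eval_mul, eval_pow, eval_C, eval_ofNat] at h1 ⊢
    -- Times `p`, the form equals `(p (u + s v) + q v) ^ 2 + (p r - q ^ 2 - l p) v ^ 2`.
    refine (mul_nonneg_iff_of_pos_left (hp t)).1 ?_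
    nlinarith [sq_nonneg (p.eval t * (u + s * v) + q.eval t * v),
      mul_nonneg (sub_nonneg.2 h1) (sq_nonneg v)]
  have hroot : (r + 2 * C s * q + C s ^ 2 * p - C l).eval a = 0 := by
    have := (hp a).ne'
    simp only [hl, hs, eval_add, eval_sub, eval_mul, eval_pow, eval_C, eval_ofNat]
    field_simp
    ring
  have hdr : (r + 2 * C s * q + C s ^ 2 * p - C l).natDegree ≤ r.natDegree := by
    have hqr : q.natDegree ≤ r.natDegree := (natDegree_le_natDegree hqp.le).trans hpr
    refine (natDegree_sub_le _ _).trans (max_le ?_ (by simp))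
    refine (natDegree_add_le _ _).trans (max_le ?_ ?_)
    · refine (natDegree_add_le _ _).trans (max_le le_rfl ?_)
      rw [show (2 : ℝ[X]) * C s = C (2 * s) by rw [C_mul]; rfl]
      exact (natDegree_C_mul_le _ _).trans hqr
    · rw [← C_pow]
      exact (natDegree_C_mul_le _ _).trans hpr
  obtain ⟨q₁, r₁, hq₁, hr₁, h₁⟩ := hpsd.extract hroot
  refine ⟨q₁, r₁, h₁, ?_, fun hsos => ?_⟩
  · rcases eq_or_ne r₁ 0 with rfl | hr10
    · simpa using hr
    · rw [hr₁, natDegree_sq_mul hr10] at hdr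
      omega
  · have h2 := (hsos.congruence 1 0 0 (X - C a)).add_sq 0 (C √l)
    have e1 : 0 ^ 2 + (1 ^ 2 * p + 2 * 1 * 0 * q₁ + 0 ^ 2 * r₁) = p := by ring
    have e2 : 0 * C √l + (1 * 0 * p + (1 * (X - C a) + 0 * 0) * q₁ + 0 * (X - C a) * r₁)
        = q + C s * p := by rw [hq₁]; ring
    have e3 : C √l ^ 2 + (0 ^ 2 * p + 2 * 0 * (X - C a) * q₁ + (X - C a) ^ 2 * r₁)
        = r + 2 * C s * q + C s ^ 2 * p := by
      rw [← C_pow, Real.sq_sqrt hl0, ← sub_eq_iff_eq_add'.2 (sub_eq_iff_eq_add'.1 hr₁)]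
      ring
    rw [e1, e2, e3] at h2
    convert h2.congruence 1 0 (-C s) 1 using 1 <;> ring

/-- Descent on `deg p + deg r`, with `deg p ≤ deg r` by symmetry. A real root of `p` is divided out.
Otherwise `q` is reduced modulo `p` by a unipotent congruence, and `exists_extract` lowers the
degree of a nonconstant `r`. -/
theorem PsdPair.sosPair {p q r : ℝ[X]} (h : PsdPair p q r) : SosPair p q r := by
  induction hN : p.natDegree + r.natDegree using Nat.strong_induction_on generalizing p q r with
  | _ N ih =>
  have ih' : ∀ {p' q' r' : ℝ[X]}, p'.natDegree + r'.natDegree < N → PsdPair p' q' r' →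
      SosPair p' q' r' := fun hlt h' => ih _ hlt h' rfl
  have main : ∀ {p q r : ℝ[X]}, p.natDegree + r.natDegree = N → PsdPair p q r → p ≠ 0 →
      p.natDegree ≤ r.natDegree → SosPair p q r := by
    clear hN h p q r
    intro p q r hN h hp0 hpr
    by_cases hroot : ∃ a, p.eval a = 0
    · obtain ⟨a, ha⟩ := hroot
      obtain ⟨q₁, p₁, rfl, rfl, h₁⟩ := h.swap.extract ha
      rw [natDegree_sq_mul (right_ne_zero_of_mul hp0)] at hN
      convert (ih' (by omega) h₁).congruence 0 (X - C a) 1 0 using 1 <;> ring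
    push Not at hroot
    have hp : ∀ t, 0 < p.eval t := fun t => (h.left_nonneg t).lt_of_ne' (hroot t)
    have hmod : q - q / p * p = q % p := by
      rw [sub_eq_iff_eq_add', mul_comm, EuclideanDomain.div_add_mod]
    have hsh := h.shift (q / p)
    rw [hmod] at hsh
    set r' := r - 2 * (q / p) * q + (q / p) ^ 2 * p with hr'
    suffices hs : SosPair p (q % p) r' by
      rw [← hmod] at hs
      convert hs.congruence 1 0 (q / p) 1 using 1 <;> ring
    have hqp : (q % p).degree < p.degree := EuclideanDomain.mod_lt q hp0
    have hle : r'.natDegree ≤ r.natDegree := by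
      rcases eq_or_ne r' 0 with h0 | hr'0
      · simp [h0]
      have hr0 : r ≠ 0 := by
        rintro rfl
        have hq0 : q = 0 := Polynomial.funext fun t => by
          have := h.sq_le t
          rw [eval_zero, mul_zero] at this
          rw [eval_zero]
          exact pow_eq_zero_iff two_ne_zero |>.1 (le_antisymm this (sq_nonneg _))
        simp [hr', hq0] at hr'0
      -- The congruence preserves the determinant, which lies between `0` and `p * r`; this bounds
      -- the degree of `r'`.
      have e : p * r' = p * r - q ^ 2 + (q % p) ^ 2 := by rw [← hmod, hr']; ring
      have h1 : (p * r - q ^ 2).natDegree ≤ (p * r).natDegree :=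
        natDegree_le_natDegree <| degree_le_of_abs_eval_le fun t => by
          have := h.sq_le t
          simp only [eval_sub, eval_mul, eval_pow]
          rw [abs_of_nonneg (by linarith), abs_of_nonneg (by nlinarith)]
          nlinarith
      have h2 : ((q % p) ^ 2).natDegree ≤ (p * r).natDegree := by
        have := natDegree_le_natDegree hqp.le
        rw [natDegree_pow, natDegree_mul hp0 hr0]
        omega
      have h3 : (p * r').natDegree ≤ (p * r).natDegree :=
        e ▸ (natDegree_add_le _ _).trans (max_le h1 h2)
      rw [natDegree_mul hp0 hr0, natDegree_mul hp0 hr'0] at h3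
      omega
    rcases hle.lt_or_eq with hlt | heq
    · exact ih' (by omega) hsh
    rcases Nat.eq_zero_or_pos r'.natDegree with h0 | hpos
    · have hpc := eq_C_of_natDegree_eq_zero (show p.natDegree = 0 by omega)
      have hrc := eq_C_of_natDegree_eq_zero h0
      have hq0 : q % p = 0 := by
        rw [degree_eq_natDegree hp0, show p.natDegree = 0 by omega] at hqp
        exact degree_eq_bot.1 (Nat.WithBot.lt_zero_iff.1 (by exact_mod_cast hqp))
      rw [hq0, hpc, hrc]
      have h1 := hsh.left_nonneg 0
      have h2 := hsh.right_nonneg 0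
      rw [← coeff_zero_eq_eval_zero] at h1 h2
      exact SosPair.diag_const h1 h2
    · obtain ⟨q₁, r₁, h₁, hlt, himp⟩ := hsh.exists_extract hp hqp (by omega) hpos
      exact himp (ih' (by omega) h₁)
  have zero_left : ∀ {q r : ℝ[X]}, r.natDegree = N → PsdPair 0 q r → SosPair 0 q r := by
    intro q r hr h
    have hq0 : q = 0 := Polynomial.funext fun t => by
      have := h.sq_le t
      rw [eval_zero, zero_mul] at this
      rw [eval_zero]
      exact pow_eq_zero_iff two_ne_zero |>.1 (le_antisymm this (sq_nonneg _))
    -- Replacing the zero entry by `1` keeps the total degree and allows `main`; a singular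
    -- congruence then erases it.
    have h1 : SosPair 1 0 r := main (by simpa using hr)
      (fun t u v => by
        have := mul_nonneg (h.right_nonneg t) (sq_nonneg v)
        simp only [eval_one, eval_zero]
        nlinarith [sq_nonneg u]) one_ne_zero (by simp)
    have := h1.congruence 0 0 0 1
    simpa [hq0] using this
  rcases eq_or_ne p 0 with rfl | hp0
  · exact zero_left (by simpa using hN) h
  rcases eq_or_ne r 0 with rfl | hr0
  · exact (zero_left (by simpa using hN) h.swap).swap
  rcases le_total p.natDegree r.natDegree with hle | hle
  · exact main hN h hp0 hle
  · exact (main (by omega) h.swap hr0 hle).swap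

/-- Squares cannot cancel: each `a i ^ 2` is bounded pointwise by `p`. -/
theorem natDegree_le_of_sum_sq {k n : ℕ} {p : ℝ[X]} {a : Fin k → ℝ[X]} (h : p = ∑ i, a i ^ 2)
    (hp : p.natDegree ≤ 2 * n) (i : Fin k) : (a i).natDegree ≤ n := by
  have h1 : (a i ^ 2).degree ≤ p.degree := degree_le_of_abs_eval_le fun t => by
    rw [h, eval_finsetSum, eval_pow, abs_of_nonneg (sq_nonneg _)]
    refine le_trans ?_ (le_abs_self _)
    simp only [eval_pow]
    exact Finset.single_le_sum (f := fun j => (a j).eval t ^ 2) (fun j _ => sq_nonneg _)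
      (Finset.mem_univ i)
  have := natDegree_le_natDegree h1
  rw [natDegree_pow] at this
  omega

end Univariate

/-! ### Ternary forms, linear coordinates and homogenization. -/

section Ternary

open MvPolynomial

theorem MvPolynomial.IsHomogeneous.exists_eval_eq_linear {f : MvPolynomial (Fin 3) ℝ}
    (hf : f.IsHomogeneous 1) : ∃ l : Fin 3 → ℝ, ∀ x, eval x f = ∑ i, l i * x i := by
  have hf' : f ∈ homogeneousSubmodule (Fin 3) ℝ 1 := hf
  rw [homogeneousSubmodule_one_eq_span_X] at hf'
  clear hf
  induction hf' using Submodule.span_induction with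
  | mem f h =>
    obtain ⟨i, rfl⟩ := h
    exact ⟨Pi.single i 1, fun x => by simp [Pi.single_apply]⟩
  | zero => exact ⟨0, fun x => by simp⟩
  | add f g _ _ h₁ h₂ =>
    obtain ⟨l, hl⟩ := h₁
    obtain ⟨m, hm⟩ := h₂
    exact ⟨l + m, fun x => by
      simp only [eval_add, hl, hm, Pi.add_apply, add_mul, Finset.sum_add_distrib]⟩
  | smul c f _ h =>
    obtain ⟨l, hl⟩ := h
    exact ⟨c • l, fun x => by
      simp only [smul_eval, hl, Pi.smul_apply, smul_eq_mul, Finset.mul_sum, mul_assoc]⟩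

theorem MvPolynomial.IsHomogeneous.exists_eval_eq_bilinear {f : MvPolynomial (Fin 3) ℝ}
    (hf : f.IsHomogeneous 2) :
    ∃ B : Matrix (Fin 3) (Fin 3) ℝ, ∀ x, eval x f = ∑ i, ∑ j, B i j * (x i * x j) := by
  have hf' : f ∈ homogeneousSubmodule (Fin 3) ℝ 2 := hf
  rw [← homogeneousSubmodule_one_pow, sq] at hf'
  clear hf
  induction hf' using Submodule.mul_induction_on' with
  | mem_mul_mem f hf g hg =>
    obtain ⟨l, hl⟩ := IsHomogeneous.exists_eval_eq_linear hf
    obtain ⟨m, hm⟩ := IsHomogeneous.exists_eval_eq_linear hg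
    refine ⟨Matrix.of fun i j => l i * m j, fun x => ?_⟩
    rw [eval_mul, hl, hm, Finset.sum_mul_sum]
    exact Finset.sum_congr rfl fun i _ => Finset.sum_congr rfl fun j _ => by
      rw [Matrix.of_apply]; ring
  | add f _ g _ h₁ h₂ =>
    obtain ⟨B₁, h₁⟩ := h₁
    obtain ⟨B₂, h₂⟩ := h₂
    exact ⟨B₁ + B₂, fun x => by
      simp only [eval_add, h₁, h₂, Matrix.add_apply, add_mul, Finset.sum_add_distrib]⟩

theorem MvPolynomial.IsHomogeneous.eval_smul_two {f : MvPolynomial (Fin 3) ℝ}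
    (hf : f.IsHomogeneous 2) (c : ℝ) (x : Fin 3 → ℝ) : eval (c • x) f = c ^ 2 * eval x f := by
  obtain ⟨B, hB⟩ := hf.exists_eval_eq_bilinear
  simp only [hB, Finset.mul_sum, Pi.smul_apply, smul_eq_mul]
  exact Finset.sum_congr rfl fun i _ => Finset.sum_congr rfl fun j _ => by ring

/-- The restriction of a quadratic form to an affine plane, as a polynomial in the coordinate
along `a`. -/
theorem MvPolynomial.IsHomogeneous.exists_eval_affine {f : MvPolynomial (Fin 3) ℝ}
    (hf : f.IsHomogeneous 2) (a u w : Fin 3 → ℝ) :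
    ∃ l m : Polynomial ℝ, l.natDegree ≤ 1 ∧ m.natDegree ≤ 2 ∧
      ∀ s t : ℝ, eval (s • a + t • u + w) f = eval a f * s ^ 2 + l.eval t * s + m.eval t := by
  obtain ⟨B, hB⟩ := hf.exists_eval_eq_bilinear
  let b : (Fin 3 → ℝ) → (Fin 3 → ℝ) → ℝ := fun x y => ∑ i, ∑ j, B i j * (x i * y j)
  refine ⟨.C (b a u + b u a) * .X + .C (b a w + b w a),
    .C (b u u) * .X ^ 2 + .C (b u w + b w u) * .X + .C (b w w), ?_, ?_, fun s t => ?_⟩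
  · compute_degree
  · compute_degree
  · simp only [hB, b, Polynomial.eval_add, Polynomial.eval_mul, Polynomial.eval_C,
      Polynomial.eval_X, Polynomial.eval_pow, Pi.add_apply, Pi.smul_apply, smul_eq_mul,
      Fin.sum_univ_three]
    ring

theorem exists_linear_coordinates {a : Fin 3 → ℝ} (ha : a ≠ 0) :
    ∃ (u w : Fin 3 → ℝ) (L : Fin 3 → MvPolynomial (Fin 3) ℝ), (∀ i, (L i).IsHomogeneous 1) ∧
      (∀ x, x = eval x (L 0) • a + eval x (L 1) • u + eval x (L 2) • w) ∧ eval w (L 2) = 1 := by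
  have h1 : LinearIndependent ℝ ![a] := by
    rw [linearIndependent_unique_iff]
    simpa using ha
  obtain ⟨u, h2⟩ := exists_linearIndependent_cons_of_lt_finrank h1 (by simp)
  obtain ⟨w, h3⟩ := exists_linearIndependent_cons_of_lt_finrank h2 (by simp)
  set Q : Matrix (Fin 3) (Fin 3) ℝ := Matrix.of ![w, u, a] with hQ
  have hQu : IsUnit Q.det :=
    (Matrix.isUnit_iff_isUnit_det Q).1 (Matrix.linearIndependent_rows_iff_isUnit.1 h3)
  have hL : ∀ (x : Fin 3 → ℝ) (j : Fin 3), eval x (∑ k, C (Q⁻¹ k j) * X k)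
      = Matrix.vecMul x Q⁻¹ j := fun x j => by
    simp [Matrix.vecMul, dotProduct, mul_comm]
  -- The rows of `Q` are `w, u, a`, hence the reversed index.
  refine ⟨u, w, fun j => ∑ k, C (Q⁻¹ k j.rev) * X k, fun j => ?_, fun x => ?_, ?_⟩
  · exact IsHomogeneous.sum _ _ _ fun k _ => isHomogeneous_C_mul_X _ _
  · have h : Matrix.vecMul (Matrix.vecMul x Q⁻¹) Q = x := by
      rw [Matrix.vecMul_vecMul, Matrix.nonsing_inv_mul _ hQu, Matrix.vecMul_one]
    simp only [hL]
    conv_lhs => rw [← h]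
    generalize Matrix.vecMul x Q⁻¹ = y
    ext k
    simp [hQ, Matrix.vecMul, dotProduct, Fin.sum_univ_three]
    ring
  · rw [hL]
    have h : Matrix.vecMul (Pi.single 0 1) Q = w := by
      simp [hQ]
    conv_lhs => rw [← h]
    rw [Matrix.vecMul_vecMul, Matrix.mul_nonsing_inv _ hQu]
    simp

/-- The homogenization, of degree `n`, of a univariate polynomial along two forms. -/
noncomputable def homogenizeAlong (n : ℕ) (f : Polynomial ℝ) (U V : MvPolynomial (Fin 3) ℝ) :
    MvPolynomial (Fin 3) ℝ :=
  ∑ k ∈ Finset.range (n + 1), C (f.coeff k) * (U ^ k * V ^ (n - k))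

theorem isHomogeneous_homogenizeAlong (n : ℕ) (f : Polynomial ℝ) {U V : MvPolynomial (Fin 3) ℝ}
    (hU : U.IsHomogeneous 1) (hV : V.IsHomogeneous 1) :
    (homogenizeAlong n f U V).IsHomogeneous n := by
  refine IsHomogeneous.sum _ _ _ fun k hk => IsHomogeneous.C_mul ?_ _
  have := (hU.pow k).mul (hV.pow (n - k))
  rwa [one_mul, one_mul, Nat.add_sub_cancel' (Nat.lt_succ_iff.1 (Finset.mem_range.1 hk))] at this

theorem eval_homogenizeAlong {n : ℕ} {f : Polynomial ℝ} (hf : f.natDegree ≤ n)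
    (U V : MvPolynomial (Fin 3) ℝ) {x : Fin 3 → ℝ} (hx : eval x V ≠ 0) :
    eval x (homogenizeAlong n f U V) = eval x V ^ n * f.eval (eval x U / eval x V) := by
  rw [Polynomial.eval_eq_sum_range' (Nat.lt_succ_of_le hf), homogenizeAlong, eval_sum,
    Finset.mul_sum]
  refine Finset.sum_congr rfl fun k hk => ?_
  have : n = (n - k) + k := (Nat.sub_add_cancel (Nat.lt_succ_iff.1 (Finset.mem_range.1 hk))).symm
  simp only [eval_mul, eval_C, eval_pow, div_pow]
  conv_rhs => rw [this, pow_add]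
  field_simp

/-- A ternary sextic of degree two in the direction `a` which is nonnegative is a sum of squares
of cubic forms. -/
theorem exists_sum_sq_of_quadratic {F : MvPolynomial (Fin 3) ℝ}
    (hF : ∀ (c : ℝ) x, eval (c • x) F = c ^ 6 * eval x F) (hnn : ∀ x, 0 ≤ eval x F)
    {a u w : Fin 3 → ℝ} {L : Fin 3 → MvPolynomial (Fin 3) ℝ} (hL : ∀ i, (L i).IsHomogeneous 1)
    (hx : ∀ x, x = eval x (L 0) • a + eval x (L 1) • u + eval x (L 2) • w)
    (hw : eval w (L 2) = 1) {p q r : Polynomial ℝ} (hp : p.natDegree ≤ 4) (hr : r.natDegree ≤ 6)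
    (h : ∀ s t : ℝ, eval (s • a + t • u + w) F
      = p.eval t * s ^ 2 + 2 * q.eval t * s + r.eval t) :
    ∃ (k : ℕ) (g : Fin k → MvPolynomial (Fin 3) ℝ),
      (∀ i, (g i).IsHomogeneous 3) ∧ F = ∑ i, g i ^ 2 := by
  have hquad : ∀ t s : ℝ, 0 ≤ p.eval t * (s * s) + 2 * q.eval t * s + r.eval t := fun t s => by
    have := hnn (s • a + t • u + w)
    rw [h] at this
    linarith
  have hpsd : PsdPair p q r := fun t x y => by
    rcases eq_or_ne y 0 with rfl | hy
    · have hpt : 0 ≤ p.eval t := by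
        by_contra! hneg
        -- Since `p` times the quadratic is `(p s + q) ^ 2 + e`, choosing `s` with `p s + q = 1 +
        -- |e|` makes this product positive, which is impossible for `p < 0`.
        set e := p.eval t * r.eval t - q.eval t ^ 2 with he
        have h1 := mul_nonpos_of_nonpos_of_nonneg hneg.le
          (hquad t ((1 + |e| - q.eval t) / p.eval t))
        have h2 : p.eval t * (p.eval t * ((1 + |e| - q.eval t) / p.eval t *
            ((1 + |e| - q.eval t) / p.eval t)) + 2 * q.eval t *
            ((1 + |e| - q.eval t) / p.eval t) + r.eval t) = (1 + |e|) ^ 2 + e := by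
          rw [he]
          have := hneg.ne
          field_simp
          ring
        rw [h2] at h1
        nlinarith [neg_abs_le e, abs_nonneg e]
      simpa using mul_nonneg hpt (sq_nonneg x)
    · have := mul_nonneg (hquad t (x / y)) (sq_nonneg y)
      have e : (p.eval t * (x / y * (x / y)) + 2 * q.eval t * (x / y) + r.eval t) * y ^ 2
          = p.eval t * x ^ 2 + 2 * q.eval t * x * y + r.eval t * y ^ 2 := by field_simp
      rwa [e] at this
  obtain ⟨k, α, β, hα, hq, hβ⟩ := hpsd.sosPair
  have hαd := natDegree_le_of_sum_sq (n := 2) hα (by omega)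
  have hβd := natDegree_le_of_sum_sq (n := 3) hβ (by omega)
  refine ⟨k, fun i => L 0 * homogenizeAlong 2 (α i) (L 1) (L 2) +
    homogenizeAlong 3 (β i) (L 1) (L 2), fun i => ?_, ?_⟩
  · exact ((hL 0).mul (isHomogeneous_homogenizeAlong 2 _ (hL 1) (hL 2))).add
      (isHomogeneous_homogenizeAlong 3 _ (hL 1) (hL 2))
  have hL2 : L 2 ≠ 0 := by
    intro h0
    simp [h0] at hw
  -- Multiplying by `L 2` leaves only points with `L 2 ≠ 0` to check, where dehomogenization is
  -- possible.
  refine mul_left_cancel₀ hL2 (MvPolynomial.funext fun x => ?_)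
  rw [eval_mul, eval_mul]
  rcases eq_or_ne (eval x (L 2)) 0 with h0 | h0
  · rw [h0, zero_mul, zero_mul]
  congr 1
  set c := eval x (L 2) with hc
  have e : x = c • ((eval x (L 0) / c) • a + (eval x (L 1) / c) • u + w) := by
    conv_lhs => rw [hx x]
    rw [smul_add, smul_add, smul_smul, smul_smul, mul_div_cancel₀ _ h0, mul_div_cancel₀ _ h0]
  have hFx : eval x F = c ^ 6 * ∑ i, ((α i).eval (eval x (L 1) / c) * (eval x (L 0) / c)
      + (β i).eval (eval x (L 1) / c)) ^ 2 := by
    conv_lhs => rw [e]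
    rw [hF, h, hα, hq, hβ]
    simp only [Polynomial.eval_finsetSum, Polynomial.eval_pow, Polynomial.eval_mul,
      Finset.mul_sum, Finset.sum_mul, ← Finset.sum_add_distrib]
    exact Finset.sum_congr rfl fun i _ => by ring
  rw [hFx, map_sum, Finset.mul_sum]
  refine Finset.sum_congr rfl fun i _ => ?_
  rw [eval_pow, eval_add, eval_mul, eval_homogenizeAlong (hαd i) _ _ h0,
    eval_homogenizeAlong (hβd i) _ _ h0, ← hc]
  field_simp

end Ternary

/-! ### The determinant in the direction of the degenerate point. -/

section Determinant

open MvPolynomial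

theorem Matrix.PosSemidef.apply_sq_le {n : Type*} [Fintype n] {A : Matrix n n ℝ}
    (hA : A.PosSemidef) (i j : n) : A i j ^ 2 ≤ A i i * A j j := by
  have h := (hA.submatrix ![i, j]).det_nonneg
  have hs : A j i = A i j := by simpa using hA.isHermitian.apply i j
  rw [Matrix.det_fin_two] at h
  simp only [Matrix.submatrix_apply, Matrix.cons_val_zero, Matrix.cons_val_one, hs] at h
  linarith

theorem eq_zero_of_forall_sq_le {b c e : ℝ} (h : ∀ s : ℝ, (b * s + c) ^ 2 ≤ e) : b = 0 := by
  by_contra hb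
  have h1 := h ((1 + |e| - c) / b)
  rw [mul_div_cancel₀ _ hb, sub_add_cancel] at h1
  nlinarith [le_abs_self e, abs_nonneg e]

theorem eq_zero_of_forall_linear_nonneg {b c : ℝ} (h : ∀ s : ℝ, 0 ≤ b * s + c) : b = 0 := by
  have := discrim_le_zero (a := 0) (b := b) (c := c) fun s => by linarith [h s]
  rw [discrim] at this
  exact pow_eq_zero_iff two_ne_zero |>.1 (le_antisymm (by linarith) (sq_nonneg b))

/-- Along `s`, the diagonal entries 11 and 22 are affine and nonnegative, hence constant; the 2×2
minor then bounds entry 12, which is constant too. Entries 01 and 02 are affine in `s`, so the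
determinant is at most quadratic. -/
theorem det_eq_sum_sq_of_eval_eq_zero
    {N : Matrix (Fin 3) (Fin 3) (MvPolynomial (Fin 3) ℝ)} (hsymm : N.IsSymm)
    (hquad : ∀ i j, (N i j).IsHomogeneous 2)
    (hpsd : ∀ a : Fin 3 → ℝ, (N.map (eval a)).PosSemidef) {a : Fin 3 → ℝ} (ha : a ≠ 0)
    (h1 : ∀ i, eval a (N i 1) = 0) (h2 : ∀ i, eval a (N i 2) = 0) :
    ∃ (k : ℕ) (g : Fin k → MvPolynomial (Fin 3) ℝ),
      (∀ i, (g i).IsHomogeneous 3) ∧ N.det = ∑ i, g i ^ 2 := by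
  obtain ⟨u, w, L, hL, hx, hw⟩ := exists_linear_coordinates ha
  choose l m hl hm hlm using fun i j => (hquad i j).exists_eval_affine a u w
  have heval : ∀ x, eval x N.det = (N.map (eval x)).det := fun x => RingHom.map_det (eval x) N
  have hl1 : ∀ t, (l 1 1).eval t = 0 := fun t => eq_zero_of_forall_linear_nonneg fun s => by
    have := (hpsd (s • a + t • u + w)).diag_nonneg (i := 1)
    rwa [Matrix.map_apply, hlm, h1, zero_mul, zero_add] at this
  have hl2 : ∀ t, (l 2 2).eval t = 0 := fun t => eq_zero_of_forall_linear_nonneg fun s => by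
    have := (hpsd (s • a + t • u + w)).diag_nonneg (i := 2)
    rwa [Matrix.map_apply, hlm, h2, zero_mul, zero_add] at this
  have hl12 : ∀ t, (l 1 2).eval t = 0 := fun t => eq_zero_of_forall_sq_le fun s => by
    have := (hpsd (s • a + t • u + w)).apply_sq_le 1 2
    simpa only [Matrix.map_apply, hlm, h1, h2, hl1, hl2, zero_mul, zero_add] using this
  have e10 : N 1 0 = N 0 1 := hsymm.apply 0 1
  have e20 : N 2 0 = N 0 2 := hsymm.apply 0 2
  have e21 : N 2 1 = N 1 2 := hsymm.apply 1 2
  -- These are the coefficients of the determinant in `s`; `q` is half the linear one, whence the `1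
  -- / 2` on `l 0 0`.
  refine exists_sum_sq_of_quadratic (F := N.det) (p := .C (eval a (N 0 0)) *
      (m 1 1 * m 2 2 - m 1 2 ^ 2) - l 0 1 ^ 2 * m 2 2 + 2 * l 0 1 * l 0 2 * m 1 2
      - l 0 2 ^ 2 * m 1 1)
    (q := .C (1 / 2) * (l 0 0 * (m 1 1 * m 2 2 - m 1 2 ^ 2)) - l 0 1 * m 0 1 * m 2 2
      + (l 0 1 * m 0 2 + l 0 2 * m 0 1) * m 1 2 - l 0 2 * m 0 2 * m 1 1)
    (r := m 0 0 * (m 1 1 * m 2 2 - m 1 2 ^ 2) - m 0 1 ^ 2 * m 2 2 + 2 * m 0 1 * m 0 2 * m 1 2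
      - m 0 2 ^ 2 * m 1 1)
    (fun c x => ?_) (fun x => ?_) hL hx hw ?_ ?_ fun s t => ?_
  · simp only [heval]
    simp only [Matrix.det_fin_three, Matrix.map_apply, (hquad _ _).eval_smul_two]
    ring
  · rw [heval]
    exact (hpsd x).det_nonneg
  · have := hm 1 1
    have := hm 2 2
    have := hm 1 2
    have := hl 0 1
    have := hl 0 2
    compute_degree
    omega
  · have := hm 0 0
    have := hm 0 1
    have := hm 0 2
    have := hm 1 1
    have := hm 2 2
    have := hm 1 2
    compute_degree
    omega
  · simp only [heval]
    simp only [Matrix.det_fin_three, Matrix.map_apply, e10, e20, e21, hlm, h1, h2, hl1, hl2,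
      hl12, Polynomial.eval_add, Polynomial.eval_sub, Polynomial.eval_mul, Polynomial.eval_pow,
      Polynomial.eval_C, Polynomial.eval_ofNat]
    ring

theorem exists_isUnit_det_mulVec_eq_zero {A : Matrix (Fin 3) (Fin 3) ℝ}
    (h : 2 ≤ Module.finrank ℝ (LinearMap.ker (Matrix.toLin' A))) :
    ∃ K : Matrix (Fin 3) (Fin 3) ℝ, IsUnit K.det ∧ A.mulVec (K 1) = 0 ∧ A.mulVec (K 2) = 0 := by
  obtain ⟨f, hf⟩ := exists_linearIndependent_of_le_finrank h
  have hf' : LinearIndependent ℝ fun i => (f i : Fin 3 → ℝ) :=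
    hf.map' (LinearMap.ker (Matrix.toLin' A)).subtype (Submodule.ker_subtype _)
  obtain ⟨v, hv⟩ := exists_linearIndependent_cons_of_lt_finrank hf' (by simp)
  exact ⟨Matrix.of (Fin.cons v fun i => (f i : Fin 3 → ℝ)),
    (Matrix.isUnit_iff_isUnit_det _).1 (Matrix.linearIndependent_rows_iff_isUnit.1 hv),
    LinearMap.mem_ker.1 (f 0).2, LinearMap.mem_ker.1 (f 1).2⟩

end Determinant

open MvPolynomial in
theorem mainTheorem6
    (M : Matrix (Fin 3) (Fin 3) (MvPolynomial (Fin 3) ℝ))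
    (hsymm : M.IsSymm)
    (hquad : ∀ i j, (M i j).IsHomogeneous 2)
    (hpsd : ∀ a : Fin 3 → ℝ, (M.map (MvPolynomial.eval a)).PosSemidef)
    (hker : ∃ a : Fin 3 → ℝ, a ≠ 0 ∧
      2 ≤ Module.finrank ℝ (LinearMap.ker (Matrix.toLin' (M.map (MvPolynomial.eval a))))) :
    ∃ (k : ℕ) (g : Fin k → MvPolynomial (Fin 3) ℝ),
      (∀ i, (g i).IsHomogeneous 3) ∧ M.det = ∑ i, g i ^ 2 := by
  obtain ⟨a, ha, hrank⟩ := hker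
  obtain ⟨K, hK, hK1, hK2⟩ := exists_isUnit_det_mulVec_eq_zero hrank
  set N : Matrix (Fin 3) (Fin 3) (MvPolynomial (Fin 3) ℝ) := K.map C * M * (K.map C).transpose
    with hN
  have hmap : ∀ x, N.map (eval x) = K * M.map (eval x) * K.transpose := fun x => by
    rw [hN, Matrix.map_mul, Matrix.map_mul, ← Matrix.transpose_map, Matrix.map_map,
      Matrix.map_map]
    have : (eval x ∘ C : ℝ → ℝ) = id := funext fun c => eval_C c
    rw [this, Matrix.map_id, Matrix.map_id]
  have hcol : ∀ i j, (M.map (eval a)).mulVec (K j) = 0 → eval a (N i j) = 0 := fun i j hj => by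
    have : (N.map (eval a)) i j = 0 := by
      rw [hmap, Matrix.mul_assoc, Matrix.mul_apply]
      refine Finset.sum_eq_zero fun k _ => ?_
      have : (M.map (eval a) * K.transpose) k j = (M.map (eval a)).mulVec (K j) k := rfl
      rw [this, hj, Pi.zero_apply, mul_zero]
    exact this
  obtain ⟨k, g, hg, hdet⟩ := det_eq_sum_sq_of_eval_eq_zero (N := N)
    (by rw [Matrix.IsSymm, hN, Matrix.transpose_mul, Matrix.transpose_mul,
          Matrix.transpose_transpose, hsymm.eq, Matrix.mul_assoc])
    (fun i j => by
      rw [hN, Matrix.mul_apply]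
      refine IsHomogeneous.sum _ _ _ fun k _ => ?_
      rw [Matrix.transpose_apply, Matrix.map_apply, mul_comm, Matrix.mul_apply]
      refine IsHomogeneous.C_mul (IsHomogeneous.sum _ _ _ fun l _ => ?_) _
      exact (hquad _ _).C_mul _)
    (fun x => by
      rw [hmap]
      simpa using (hpsd x).mul_mul_conjTranspose_same K)
    ha (fun i => hcol i 1 hK1) (fun i => hcol i 2 hK2)
  -- The scaling undoes `det N = (det K) ^ 2 * det M`.
  refine ⟨k, fun i => C (K.det)⁻¹ * g i, fun i => (hg i).C_mul _, ?_⟩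
  have hdetN : N.det = C (K.det ^ 2) * M.det := by
    have : (K.map C : Matrix _ _ (MvPolynomial (Fin 3) ℝ)).det = C K.det :=
      (RingHom.map_det C K).symm
    rw [hN, Matrix.det_mul, Matrix.det_mul, Matrix.det_transpose, this, C_pow]
    ring
  simp only [mul_pow, ← Finset.mul_sum]
  rw [← hdet, hdetN, ← C_pow, ← mul_assoc, ← C_mul, ← mul_pow, inv_mul_cancel₀ hK.ne_zero,
    one_pow, C_1, one_mul]
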